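/- For matrices $A=(a_1\,|\cdots|\,a_m)\in\mathbb{R}^{n\times m}$ and $B=(b_1\,|\cdots|\,b_m)\in\mathbb{R}^{n\times m}$, let $A\odot B\in\mathbb{R}^{n^2\times m}$ denote their Khatri–Rao product, the matrix whose $j$-th column is the Kronecker product $a_j\otimes b_j$. For a matrix $M$ with $m\ge 1$ columns and at least $m$ rows, let $\sigma_{\min}(M)=\sigma_m(M)$ denote its least singular value. There exist absolute constants $C,c,\kappa>0$ and $a,b\in\mathbb{N}$ such that the following holds. Let $n,m\ge 1$ be integers with $m\le n^2/C$, let $\rho>0$, and let $U,V\in\mathbb{R}^{n\times m}$ be arbitrary. Let $\tilde U=U+E$ and $\tilde V=V+F$, where all $2nm$ entries of the random matrices $E,F\in\mathbb{R}^{n\times m}$ are independent Gaussians $\mathcal{N}(0,\rho^2)$. Then $$\Pr\left[\sigma_{\min}(\tilde U\odot\tilde V)\ \ge\ \kappa\,\rho^{a}\,n^{-b}\right]\ \ge\ 1-\exp(-c\,n).$$ -/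

import Mathlib

open MeasureTheory ProbabilityTheory

/-- The Khatri–Rao product: the `j`-th column is the Kronecker product of the `j`-th column of `A`
and the `j`-th column of `B` (rows are indexed by pairs). -/
def Matrix.khatriRao {n k m : ℕ} (A : Matrix (Fin n) (Fin m) ℝ) (B : Matrix (Fin k) (Fin m) ℝ) :
    Matrix (Fin n × Fin k) (Fin m) ℝ :=
  Matrix.of fun p j => A p.1 j * B p.2 j

/-- The least singular value `σ_m` of a matrix with `m ≥ 1` columns. Mathlib's singular values are
indexed from `0`, in decreasing order, with respect to the Euclidean norms. -/
noncomputable def Matrix.sigmaMin {ι : Type*} [Fintype ι] {m : ℕ} (A : Matrix ι (Fin m) ℝ) : ℝ :=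
  (Matrix.toEuclideanLin A).singularValues (m - 1)

/-! Rescaling reduces to ρ = 1. If the product nearly kills a vector, dividing by its largest
coordinate shows that some column j lies near the span of the others. Since (u+e)⊗(v+f) = e⊗f +
u⊗(v+f) + e⊗v, the tensor e⊗f is then near W, the span of the other columns, u⊗ℝⁿ and ℝⁿ⊗v. Given
the other columns, W is fixed and has dimension at most m + 2n, a small fraction of n²
(`exists_orthogonal_forms`). A union bound over j finishes.

The core is `measure_tensor_le`: a Gaussian e⊗f is rarely within τ = n^(-O(1)) of a fixed W with dim
W ≤ n²/18. Suppose the bad set of pairs has measure above 2q, with q = e^(-4(n-⌊n/2⌋)). By Fubini,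
more than q of the e have a slice of measure more than q. A set of measure above q contains h =
⌊n/2⌋ vectors that, completed by unit vectors, have determinant at least e^(-4h)
(`exists_matrix_rows_mem`). Applied to the e, then to the f in each slice, this yields h² bad
tensors among the rows of an n²×n² matrix of determinant at least e^(-8hn) (`exists_tensor_family`,
`Matrix.det_row_tensor`). In an orthonormal basis adapted to W those h² rows have entries at most τ
off dim W columns, so the determinant is at most n^(6n²) τ^(h² - dim W). As h² ≥ n²/9, this is a
contradiction for τ a small enough power of 1/n. -/

/-! ### Gaussian small balls and robustly independent rows. -/

theorem gaussianReal_interval_le (a s : ℝ) :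
    gaussianReal 0 1 {x | |x - a| < s} ≤ ENNReal.ofReal s := by
  have hset : {x : ℝ | |x - a| < s} = Metric.ball a s := by
    ext x; simp [Real.dist_eq]
  rw [hset, gaussianReal_apply 0 one_ne_zero]
  have hpdf : ∀ x, gaussianPDF 0 1 x ≤ ENNReal.ofReal (1 / 2) := by
    intro x
    apply ENNReal.ofReal_le_ofReal
    rw [gaussianPDFReal_def]
    have h2 : (2 : ℝ) ≤ √(2 * Real.pi * 1) := by
      apply Real.le_sqrt_of_sq_le
      nlinarith [Real.pi_gt_three]
    have h3 : Real.exp (-(x - 0) ^ 2 / (2 * 1)) ≤ 1 := by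
      apply Real.exp_le_one_iff.2
      nlinarith [sq_nonneg x]
    calc (√(2 * Real.pi * (1 : NNReal)))⁻¹ * Real.exp (-(x - 0) ^ 2 / (2 * (1 : NNReal)))
        ≤ 2⁻¹ * 1 := by
          push_cast
          gcongr
      _ = 1 / 2 := by norm_num
  calc ∫⁻ x in Metric.ball a s, gaussianPDF 0 1 x
      ≤ ∫⁻ _ in Metric.ball a s, ENNReal.ofReal (1 / 2) := lintegral_mono fun x => hpdf x
    _ = ENNReal.ofReal s := by
      rw [setLIntegral_const, Real.volume_ball, ← ENNReal.ofReal_mul (by norm_num)]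
      congr 1; ring

/-- The standard Gaussian measure on `ι → ℝ`. -/
noncomputable abbrev stdGauss (ι : Type*) [Fintype ι] : Measure (ι → ℝ) :=
  Measure.pi fun _ => gaussianReal 0 1

/-- Once the coordinates in `I` are fixed, the centres `φ` are constants and the remaining
coordinates are independent, each contributing a factor at most s. -/
theorem stdGauss_small_ball {ι : Type*} [Fintype ι] [DecidableEq ι] (I : Finset ι)
    (φ : ({i // i ∈ I} → ℝ) → ι → ℝ) (hφ : Measurable φ) (s : ℝ) :
    stdGauss ι {x | ∀ k ∉ I, |x k - φ (fun i => x i) k| < s} ≤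
      ENNReal.ofReal s ^ (Fintype.card ι - I.card) := by
  have hmp := measurePreserving_piEquivPiSubtypeProd (α := fun _ : ι => ℝ)
    (fun _ => gaussianReal 0 1) (fun i => i ∈ I)
  set B : Set (({i // i ∈ I} → ℝ) × ({i // ¬ i ∈ I} → ℝ)) :=
    {z | ∀ k : {i // ¬ i ∈ I}, |z.2 k - φ z.1 k| < s} with hB
  have hBm : MeasurableSet B := by
    rw [hB, Set.ofPred_forall]
    refine MeasurableSet.iInter fun k => measurableSet_lt ?_ measurable_const
    have h1 : Measurable fun z : ({i // i ∈ I} → ℝ) × ({i // ¬ i ∈ I} → ℝ) => φ z.1 k :=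
      (measurable_pi_apply (k : ι)).comp (hφ.comp measurable_fst)
    have h2 : Measurable fun z : ({i // i ∈ I} → ℝ) × ({i // ¬ i ∈ I} → ℝ) => z.2 k :=
      (measurable_pi_apply k).comp measurable_snd
    exact (h2.sub h1).abs
  have hset : {x : ι → ℝ | ∀ k ∉ I, |x k - φ (fun i => x i) k| < s} =
      (MeasurableEquiv.piEquivPiSubtypeProd (fun _ : ι => ℝ) (fun i => i ∈ I)) ⁻¹' B := by
    ext x
    simp [hB, MeasurableEquiv.piEquivPiSubtypeProd, Equiv.piEquivPiSubtypeProd]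
  rw [hset, hmp.measure_preimage hBm.nullMeasurableSet, Measure.prod_apply hBm]
  have hslice : ∀ y : {i // i ∈ I} → ℝ,
      (Measure.pi fun _ : {i // ¬ i ∈ I} => gaussianReal 0 1) (Prod.mk y ⁻¹' B) ≤
        ENNReal.ofReal s ^ (Fintype.card ι - I.card) := by
    intro y
    have : Prod.mk y ⁻¹' B = Set.univ.pi fun k : {i // ¬ i ∈ I} => {t : ℝ | |t - φ y k| < s} := by
      ext z; simp [hB]
    rw [this, Measure.pi_pi]
    refine (Finset.prod_le_prod' fun (k : {i // ¬ i ∈ I}) _ => gaussianReal_interval_le (φ y k) s).trans ?_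
    rw [Finset.prod_const, Finset.card_univ, Fintype.card_subtype_compl]
    simp
  refine (lintegral_mono hslice).trans ?_
  simp

/-- Among the coordinates of `x` outside `I`, only `x k` matters: any other one contributes a
determinant with a repeated unit row. -/
theorem Matrix.det_updateRow_of_single_rows {ι : Type*} [Fintype ι] [DecidableEq ι] (I : Finset ι)
    (M : Matrix ι ι ℝ) (hM : ∀ i ∉ I, M i = Pi.single i 1) {k : ι} (hk : k ∉ I) (x : ι → ℝ) :
    (M.updateRow k x).det =
      (M.updateRow k fun i => if i ∈ I then x i else 0).det + x k * M.det := by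
  have hsplit : x = (fun i => if i ∈ I then x i else 0) +
      ∑ l ∈ Iᶜ, x l • (Pi.single l 1 : ι → ℝ) := by
    ext i
    simp only [Pi.add_apply, Finset.sum_apply, Pi.smul_apply, Pi.single_apply, smul_eq_mul,
      mul_ite, mul_one, mul_zero, Finset.sum_ite_eq, Finset.mem_compl]
    by_cases h : i ∈ I <;> simp [h]
  have hlin : ∀ y, (M.updateRow k y).det = Matrix.cramer M.transpose y k := fun y =>
    (Matrix.cramer_transpose_apply M y k).symm
  have hL : ∀ l ∈ Iᶜ, l ≠ k → x l * (M.updateRow k (Pi.single l 1)).det = 0 := by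
    intro l hl hlk
    rw [← hM l (by simpa using hl)]
    rw [Matrix.det_zero_of_row_eq hlk.symm (by simp [hlk]), mul_zero]
  conv_lhs => rw [hsplit]
  rw [hlin, map_add, Pi.add_apply, ← hlin, map_sum, Finset.sum_apply]
  congr 1
  simp only [← hlin, Matrix.det_updateRow_smul]
  rw [Finset.sum_eq_single k hL (by simp [hk]), ← hM k hk, Matrix.updateRow_eq_self]

/-- A set of large Gaussian measure contains many robustly independent vectors. -/
theorem exists_matrix_rows_mem {ι : Type*} [Fintype ι] [DecidableEq ι] {A : Set (ι → ℝ)} {s : ℝ}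
    (hs : 0 < s) {q : ENNReal} (hA : q < stdGauss ι A) (h : ℕ) (hh : h ≤ Fintype.card ι)
    (hq : ∀ j < h, ENNReal.ofReal s ^ (Fintype.card ι - j) ≤ q) :
    ∃ (M : Matrix ι ι ℝ) (I : Finset ι), I.card = h ∧ (∀ i ∈ I, M i ∈ A) ∧
      (∀ i ∉ I, M i = Pi.single i 1) ∧ s ^ h ≤ |M.det| := by
  induction h with
  | zero =>
    refine ⟨1, ∅, rfl, by simp, fun i _ => ?_, by simp⟩
    ext j
    simp [Matrix.one_apply, Pi.single_apply, eq_comm]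
  | succ j ih =>
    obtain ⟨M, I, hI, hIA, hIs, hdet⟩ := ih (by omega) fun i hi => hq i (by omega)
    have hd : 0 < |M.det| := lt_of_lt_of_le (by positivity) hdet
    have hd0 : M.det ≠ 0 := abs_pos.1 hd
    -- The value of `x k` at which the updated determinant vanishes; it depends only on the
    -- coordinates in `I`, so the new determinant is `(x k - φ k) * M.det`.
    set φ : ({i // i ∈ I} → ℝ) → ι → ℝ := fun y k =>
      -(M.updateRow k fun i => if hi : i ∈ I then y ⟨i, hi⟩ else 0).det / M.det with hφ
    have hφm : Measurable φ := by
      refine measurable_pi_lambda _ fun k => Continuous.measurable ?_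
      refine Continuous.div_const (Continuous.neg (Continuous.matrix_det ?_)) _
      refine continuous_const.matrix_updateRow k (continuous_pi fun i => ?_)
      by_cases hi : i ∈ I <;> simp only [hi, dite_true, dite_false] <;> fun_prop
    have hsmall : stdGauss ι {x | ∀ k ∉ I, |x k - φ (fun i => x i) k| < s} ≤ q :=
      (stdGauss_small_ball I φ hφm s).trans (by rw [hI]; exact hq j (by omega))
    obtain ⟨x, hxA, hx⟩ : ∃ x ∈ A, x ∉ {x : ι → ℝ | ∀ k ∉ I, |x k - φ (fun i => x i) k| < s} := by
      by_contra! hcon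
      exact absurd ((measure_mono hcon).trans hsmall) (not_le.2 hA)
    simp only [Set.mem_ofPred_eq, not_forall, not_lt] at hx
    obtain ⟨k, hk, hxk⟩ := hx
    refine ⟨M.updateRow k x, insert k I, by simp [hk, hI], ?_, ?_, ?_⟩
    · intro i hi
      by_cases hik : i = k
      · subst hik; simpa using hxA
      · have : i ∈ I := by simpa [hik] using hi
        simpa [Matrix.updateRow_ne hik] using hIA i this
    · intro i hi
      simp only [Finset.mem_insert, not_or] at hi
      simpa [Matrix.updateRow_ne hi.1] using hIs i hi.2
    · have hval : (M.updateRow k x).det = (x k - φ (fun i => x i) k) * M.det := by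
        rw [Matrix.det_updateRow_of_single_rows I M hIs hk x, hφ]
        simp only [dite_eq_ite]
        field_simp
        ring
      rw [hval, abs_mul, pow_succ']
      gcongr

/-! ### Determinants of families of rank one tensors. -/

/-- The matrix factors as the block diagonal of the `F i` times E ⊗ 1. -/
theorem Matrix.det_row_tensor {ι κ : Type*} [Fintype ι] [DecidableEq ι] [Fintype κ] [DecidableEq κ]
    (E : Matrix ι ι ℝ) (F : ι → Matrix κ κ ℝ) :
    (Matrix.of fun (p q : ι × κ) => E p.1 q.1 * F p.1 p.2 q.2).det =
      (∏ i, (F i).det) * E.det ^ Fintype.card κ := by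
  have hmul : (Matrix.of fun (p q : ι × κ) => E p.1 q.1 * F p.1 p.2 q.2) =
      (Matrix.blockDiagonal F).submatrix (Equiv.prodComm ι κ) (Equiv.prodComm ι κ) *
        Matrix.kronecker E (1 : Matrix κ κ ℝ) := by
    ext p q
    simp only [Matrix.mul_apply, Matrix.submatrix_apply, Fintype.sum_prod_type,
      Matrix.blockDiagonal_apply, Matrix.of_apply, Equiv.prodComm_apply, Prod.fst_swap,
      Prod.snd_swap, Matrix.kronecker, Matrix.kroneckerMap_apply]
    simp [Matrix.one_apply, mul_comm]
  rw [hmul, Matrix.det_mul, Matrix.det_submatrix_equiv_self, Matrix.det_blockDiagonal,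
    Matrix.kronecker, Matrix.det_kronecker]
  simp

/-- A matrix with a large block of tiny entries has a small determinant. -/
theorem Matrix.abs_det_mul_pow_le {κ : Type*} [Fintype κ] [DecidableEq κ] (M : Matrix κ κ ℝ)
    (G s : Finset κ) {τ K : ℝ} (hτ : 0 < τ) (hτ1 : τ ≤ 1) (hK : 1 ≤ K)
    (hM : ∀ g p, |M g p| ≤ K) (hG : ∀ g ∈ G, ∀ p ∉ s, |M g p| ≤ τ) :
    |M.det| * τ ^ s.card ≤ (Fintype.card κ).factorial * K ^ Fintype.card κ * τ ^ G.card := by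
  -- Enlarging the rows in `G` by τ⁻¹ and shrinking the columns in `s` by τ keeps every entry below
  -- K.
  set N : Matrix κ κ ℝ := Matrix.diagonal (fun g => if g ∈ G then τ⁻¹ else 1) * M *
    Matrix.diagonal (fun p => if p ∈ s then τ else 1) with hN
  have hent : ∀ g p, |N g p| ≤ K := by
    intro g p
    rw [hN, Matrix.mul_diagonal, Matrix.diagonal_mul]
    have h1 := hM g p
    have h0 := abs_nonneg (M g p)
    by_cases hg : g ∈ G <;> by_cases hp : p ∈ s <;> simp only [hg, hp, if_true, if_false, abs_mul,
      abs_inv, abs_of_pos hτ, one_mul, mul_one]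
    · rwa [mul_comm τ⁻¹, mul_assoc, inv_mul_cancel₀ hτ.ne', mul_one]
    · rw [inv_mul_le_iff₀ hτ]
      nlinarith [hG g hg p hp]
    · nlinarith
    · exact h1
  have hdet := Matrix.det_le (abv := AbsoluteValue.abs) (A := N) (x := K) (fun i j => hent i j)
  have hval : N.det = (τ⁻¹) ^ G.card * M.det * τ ^ s.card := by
    rw [hN, Matrix.det_mul, Matrix.det_mul, Matrix.det_diagonal, Matrix.det_diagonal]
    simp
  rw [hval] at hdet
  simp only [AbsoluteValue.abs_apply, abs_mul, abs_pow, abs_inv, abs_of_pos hτ, nsmul_eq_mul]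
    at hdet
  have h2 : τ ^ G.card * (τ⁻¹ ^ G.card) = 1 := by
    rw [← mul_pow, mul_inv_cancel₀ hτ.ne', one_pow]
  calc |M.det| * τ ^ s.card = τ ^ G.card * (τ⁻¹ ^ G.card) * |M.det| * τ ^ s.card := by
        rw [h2, one_mul]
    _ = τ ^ G.card * (τ⁻¹ ^ G.card * |M.det| * τ ^ s.card) := by ring
    _ ≤ τ ^ G.card * ((Fintype.card κ).factorial * K ^ Fintype.card κ) := by gcongr
    _ = _ := by ring

/-- If the set of `e` having many `f` with `(e, f)` in `S` is large, the tensors `e ⊗ f` with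
`(e, f) ∈ S` contain a robustly independent family of size `h ^ 2`. -/
theorem exists_tensor_family {n h : ℕ} (hh : h ≤ n) {S : Set ((Fin n → ℝ) × (Fin n → ℝ))} {s : ℝ}
    (hs : 0 < s) {q : ENNReal} (hq : ∀ j < h, ENNReal.ofReal s ^ (n - j) ≤ q)
    (hA : q < stdGauss (Fin n) {x | q < stdGauss (Fin n) (Prod.mk x ⁻¹' S)}) :
    ∃ (E : Matrix (Fin n) (Fin n) ℝ) (F : Fin n → Matrix (Fin n) (Fin n) ℝ)
      (G : Finset (Fin n × Fin n)), G.card = h * h ∧ (∀ p ∈ G, (E p.1, F p.1 p.2) ∈ S) ∧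
      (∀ i, (∃ y, (E i, y) ∈ S) ∨ E i = Pi.single i 1) ∧
      (∀ i j, (∃ x, (x, F i j) ∈ S) ∨ F i j = Pi.single j 1) ∧
      s ^ h ≤ |E.det| ∧ (∀ i, s ^ h ≤ |(F i).det| ∨ F i = 1) := by
  have hcard : Fintype.card (Fin n) = n := Fintype.card_fin n
  obtain ⟨E, I, hI, hIA, hIs, hEdet⟩ := exists_matrix_rows_mem hs hA h (by rwa [hcard])
    (by rwa [hcard])
  have hF : ∀ i, ∃ (M : Matrix (Fin n) (Fin n) ℝ) (J : Finset (Fin n)),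
      (∀ j ∉ J, M j = Pi.single j 1) ∧ (i ∈ I → J.card = h ∧ (∀ j ∈ J, (E i, M j) ∈ S) ∧
        s ^ h ≤ |M.det|) ∧ (i ∉ I → M = 1 ∧ J = ∅) := by
    intro i
    by_cases hi : i ∈ I
    · obtain ⟨M, J, h1, h2, h3, h4⟩ := exists_matrix_rows_mem hs (hIA i hi) h (by rwa [hcard])
        (by rwa [hcard])
      exact ⟨M, J, h3, fun _ => ⟨h1, h2, h4⟩, fun hi' => absurd hi hi'⟩
    · refine ⟨1, ∅, fun j _ => ?_, fun hi' => absurd hi' hi, fun _ => ⟨rfl, rfl⟩⟩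
      ext k
      simp [Matrix.one_apply, Pi.single_apply, eq_comm]
  choose F J hFs hFI hFn using hF
  refine ⟨E, F, (I.sigma J).map (Equiv.sigmaEquivProd _ _).toEmbedding, ?_, ?_, ?_, ?_, hEdet, ?_⟩
  · rw [Finset.card_map, Finset.card_sigma, Finset.sum_congr rfl fun i hi => (hFI i hi).1]
    simp [hI]
  · rintro ⟨i, j⟩ hp
    have hp' : i ∈ I ∧ j ∈ J i := by simpa using hp
    exact (hFI i hp'.1).2.1 j hp'.2
  · intro i
    by_cases hi : i ∈ I
    · have h1 : q < stdGauss (Fin n) (Prod.mk (E i) ⁻¹' S) := hIA i hi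
      obtain ⟨y, hy⟩ := nonempty_of_measure_ne_zero (ne_bot_of_gt h1)
      exact Or.inl ⟨y, hy⟩
    · exact Or.inr (hIs i hi)
  · intro i j
    by_cases hj : j ∈ J i
    · by_cases hi : i ∈ I
      · exact Or.inl ⟨_, (hFI i hi).2.1 j hj⟩
      · rw [(hFn i hi).2] at hj
        simp at hj
    · exact Or.inr (hFs i j hj)
  · intro i
    by_cases hi : i ∈ I
    · exact Or.inl (hFI i hi).2.2
    · exact Or.inr (hFn i hi).1

/-! ### Gaussian rank one tensors avoid small subspaces. -/

theorem prod_stdGauss_le_two_mul {n : ℕ} {S : Set ((Fin n → ℝ) × (Fin n → ℝ))}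
    (hS : MeasurableSet S) {q : ENNReal}
    (hA : stdGauss (Fin n) {x | q < stdGauss (Fin n) (Prod.mk x ⁻¹' S)} ≤ q) :
    ((stdGauss (Fin n)).prod (stdGauss (Fin n))) S ≤ 2 * q := by
  set A := {x | q < stdGauss (Fin n) (Prod.mk x ⁻¹' S)} with hAdef
  have hAm : MeasurableSet A := measurableSet_lt measurable_const (measurable_measure_prodMk_left hS)
  rw [Measure.prod_apply hS]
  calc ∫⁻ x, stdGauss (Fin n) (Prod.mk x ⁻¹' S) ∂stdGauss (Fin n)
      ≤ ∫⁻ x, (A.indicator 1 x + q) ∂stdGauss (Fin n) := by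
        refine lintegral_mono fun x => ?_
        by_cases hx : x ∈ A
        · simp only [hx, Set.indicator_of_mem, Pi.one_apply]
          exact prob_le_one.trans le_self_add
        · simp only [hx, not_false_eq_true, Set.indicator_of_notMem, zero_add]
          exact not_lt.1 hx
    _ = stdGauss (Fin n) A + q := by
        rw [lintegral_add_right _ measurable_const, lintegral_indicator_one hAm]
        simp
    _ ≤ 2 * q := by rw [two_mul]; gcongr

theorem gaussianReal_abs_gt_le (R : ℝ) :
    gaussianReal 0 1 {x | R < |x|} ≤ ENNReal.ofReal (2 * Real.exp (8 - 4 * R)) := by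
  have hint : ∀ t : ℝ, Integrable (fun x => Real.exp (t * id x)) (gaussianReal 0 1) := fun t =>
    integrable_exp_mul_gaussianReal t
  have hm : ∀ t : ℝ, mgf id (gaussianReal 0 1) t = Real.exp (t ^ 2 / 2) := by
    intro t
    rw [mgf_gaussianReal (μ := 0) (v := 1) (by simp) t]
    simp
  have h1 := measure_ge_le_exp_mul_mgf (μ := gaussianReal 0 1) (X := id) (t := 4) R (by norm_num)
    (hint 4)
  have h2 := measure_le_le_exp_mul_mgf (μ := gaussianReal 0 1) (X := id) (t := -4) (-R)
    (by norm_num) (hint (-4))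
  rw [hm, ← Real.exp_add] at h1 h2
  rw [← ofReal_measureReal]
  apply ENNReal.ofReal_le_ofReal
  have hsub : {x : ℝ | R < |x|} ⊆ {x | R ≤ id x} ∪ {x | id x ≤ -R} := by
    intro x hx
    have hx' : R < |x| := hx
    rcases lt_abs.1 hx' with h | h
    · exact Or.inl h.le
    · exact Or.inr (by simp only [Set.mem_ofPred_eq, id]; linarith)
  calc (gaussianReal 0 1).real {x | R < |x|}
      ≤ (gaussianReal 0 1).real {x | R ≤ id x} + (gaussianReal 0 1).real {x | id x ≤ -R} :=
        (measureReal_mono hsub).trans (measureReal_union_le _ _)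
    _ ≤ Real.exp (-4 * R + 4 ^ 2 / 2) + Real.exp (- -4 * -R + (-4) ^ 2 / 2) := add_le_add h1 h2
    _ = 2 * Real.exp (8 - 4 * R) := by
      rw [two_mul]; congr 2 <;> ring

theorem stdGauss_exists_abs_gt_le (n : ℕ) (R : ℝ) :
    stdGauss (Fin n) {x | ∃ i, R < |x i|} ≤ n * ENNReal.ofReal (2 * Real.exp (8 - 4 * R)) := by
  have : {x : Fin n → ℝ | ∃ i, R < |x i|} = ⋃ i, {x | R < |x i|} := by ext x; simp
  rw [this]
  refine (measure_iUnion_le _).trans ?_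
  rw [tsum_fintype]
  refine (Finset.sum_le_card_nsmul _ _ _ fun i _ => ?_).trans_eq (by
    rw [Finset.card_univ, Fintype.card_fin, nsmul_eq_mul])
  have hm : MeasurableSet {x : ℝ | R < |x|} := measurableSet_lt measurable_const (by fun_prop)
  have := (measurePreserving_eval (fun _ : Fin n => gaussianReal 0 1) i).measure_preimage
    hm.nullMeasurableSet
  exact this.trans_le (gaussianReal_abs_gt_le R)

/-- The scale at which a Gaussian rank one tensor avoids a fixed subspace. -/
noncomputable def tensorScale (n : ℕ) : ℝ := 2⁻¹ * ((Real.exp 4 * (n : ℝ) ^ 6) ^ 18)⁻¹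

theorem tensorScale_pos {n : ℕ} (hn : 0 < n) : 0 < tensorScale n := by
  unfold tensorScale; positivity

theorem tensorScale_le_one {n : ℕ} (hn : 0 < n) : tensorScale n ≤ 1 := by
  have hn1 : (1 : ℝ) ≤ n := by exact_mod_cast hn
  have h1 : (1 : ℝ) ≤ (Real.exp 4 * (n : ℝ) ^ 6) ^ 18 :=
    one_le_pow₀ (one_le_mul_of_one_le_of_one_le (Real.one_le_exp (by norm_num)) (one_le_pow₀ hn1))
  have h2 := inv_le_one_of_one_le₀ h1
  have h3 : 0 ≤ ((Real.exp 4 * (n : ℝ) ^ 6) ^ 18)⁻¹ := by positivity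
  unfold tensorScale
  linarith

theorem tensorScale_pow_contradiction {n h D : ℕ} (hn : 0 < n) (h2 : 2 * h ≤ n) (h3 : n ≤ 3 * h)
    (hD : 18 * D ≤ n ^ 2) :
    ((n * n).factorial : ℝ) * ((n : ℝ) ^ 4) ^ (n * n) * tensorScale n ^ (h * h) <
      Real.exp (-4) ^ (2 * h * n) * tensorScale n ^ D := by
  have hτ := tensorScale_pos hn
  have hτ1 := tensorScale_le_one hn
  set τ := tensorScale n with hτdef
  set d := n * n with hd
  have hd0 : d ≠ 0 := by positivity
  have hd1 : 18 * D ≤ d := by rw [hd]; nlinarith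
  have hd2 : d * 2 ≤ 18 * (h * h) := by rw [hd]; nlinarith
  have hfac : ((n * n).factorial : ℝ) * ((n : ℝ) ^ 4) ^ (n * n) ≤ ((n : ℝ) ^ 6) ^ d := by
    have : ((n * n).factorial : ℝ) ≤ ((n * n : ℕ) : ℝ) ^ d := by
      exact_mod_cast Nat.factorial_le_pow _
    calc ((n * n).factorial : ℝ) * ((n : ℝ) ^ 4) ^ (n * n)
        ≤ ((n * n : ℕ) : ℝ) ^ d * ((n : ℝ) ^ 4) ^ d := by gcongr
      _ = ((n : ℝ) ^ 6) ^ d := by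
        rw [← mul_pow]; push_cast; congr 1; ring
  have hexp : Real.exp (-4) ^ d ≤ Real.exp (-4) ^ (2 * h * n) := by
    apply pow_le_pow_of_le_one (Real.exp_pos _).le (Real.exp_le_one_iff.2 (by norm_num))
    rw [hd]; gcongr
  -- Taking 18th powers and using 18h² ≥ 2d and 18D ≤ d reduces this to n^108 τ² < e^(-72) τ;
  -- `tensorScale` makes n^108 τ equal to half of e^(-72).
  have hmain : ((n : ℝ) ^ 6) ^ d * τ ^ (h * h) < Real.exp (-4) ^ d * τ ^ D := by
    refine lt_of_pow_lt_pow_left₀ 18 (by positivity) ?_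
    have e1 : (((n : ℝ) ^ 6) ^ d * τ ^ (h * h)) ^ 18 ≤ (((n : ℝ) ^ 6) ^ 18 * τ ^ 2) ^ d := by
      have : τ ^ (18 * (h * h)) ≤ τ ^ (2 * d) :=
        pow_le_pow_of_le_one hτ.le hτ1 (by omega)
      calc (((n : ℝ) ^ 6) ^ d * τ ^ (h * h)) ^ 18
          = (((n : ℝ) ^ 6) ^ 18) ^ d * τ ^ (18 * (h * h)) := by
            rw [mul_pow, ← pow_mul, ← pow_mul, ← pow_mul, ← pow_mul, ← pow_mul]
            congr 2 <;> ring
        _ ≤ (((n : ℝ) ^ 6) ^ 18) ^ d * τ ^ (2 * d) := by gcongr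
        _ = _ := by rw [mul_pow, pow_mul τ]
    have e2 : (Real.exp (-4) ^ 18 * τ) ^ d ≤ (Real.exp (-4) ^ d * τ ^ D) ^ 18 := by
      have : τ ^ d ≤ τ ^ (18 * D) := pow_le_pow_of_le_one hτ.le hτ1 hd1
      calc (Real.exp (-4) ^ 18 * τ) ^ d = (Real.exp (-4) ^ 18) ^ d * τ ^ d := mul_pow _ _ _
        _ ≤ (Real.exp (-4) ^ 18) ^ d * τ ^ (18 * D) := by gcongr
        _ = _ := by
          rw [mul_pow, ← pow_mul, ← pow_mul, ← pow_mul]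
          congr 2 <;> ring
    refine e1.trans_lt (lt_of_lt_of_le ?_ e2)
    refine pow_lt_pow_left₀ ?_ (by positivity) hd0
    have e3 : ((n : ℝ) ^ 6) ^ 18 * τ = 2⁻¹ * Real.exp (-4) ^ 18 := by
      have hn0 : (n : ℝ) ≠ 0 := by positivity
      rw [hτdef, tensorScale, Real.exp_neg]
      field_simp
    calc ((n : ℝ) ^ 6) ^ 18 * τ ^ 2 = (((n : ℝ) ^ 6) ^ 18 * τ) * τ := by ring
      _ = 2⁻¹ * (Real.exp (-4) ^ 18 * τ) := by rw [e3]; ring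
      _ < Real.exp (-4) ^ 18 * τ := by
        have : 0 < Real.exp (-4) ^ 18 * τ := by positivity
        linarith
  calc ((n * n).factorial : ℝ) * ((n : ℝ) ^ 4) ^ (n * n) * τ ^ (h * h)
      ≤ ((n : ℝ) ^ 6) ^ d * τ ^ (h * h) := by gcongr
    _ < Real.exp (-4) ^ d * τ ^ D := hmain
    _ ≤ _ := by gcongr

theorem measure_bounded_tensor_le {n : ℕ} (hn : 2 ≤ n)
    (Q : Matrix (Fin n × Fin n) (Fin n × Fin n) ℝ) (hQ : ∀ p r, |Q p r| ≤ 1) (hdet : |Q.det| = 1)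
    (s : Finset (Fin n × Fin n)) (hs : 18 * s.card ≤ n ^ 2) :
    ((stdGauss (Fin n)).prod (stdGauss (Fin n))) {z | (∀ i, |z.1 i| ≤ n ∧ |z.2 i| ≤ n) ∧
      ∀ k ∉ s, |∑ p, Q k p * (z.1 p.1 * z.2 p.2)| ≤ tensorScale n} ≤
      2 * ENNReal.ofReal (Real.exp (-4)) ^ (n - n / 2) := by
  have hn0 : 0 < n := by omega
  set S : Set ((Fin n → ℝ) × (Fin n → ℝ)) := {z | (∀ i, |z.1 i| ≤ n ∧ |z.2 i| ≤ n) ∧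
      ∀ k ∉ s, |∑ p, Q k p * (z.1 p.1 * z.2 p.2)| ≤ tensorScale n} with hSdef
  have hSc : IsClosed S := by
    simp only [hSdef, Set.ofPred_and, Set.ofPred_forall]
    refine IsClosed.inter (isClosed_iInter fun i => IsClosed.inter
      (isClosed_le (by fun_prop) (by fun_prop)) (isClosed_le (by fun_prop) (by fun_prop)))
      (isClosed_iInter fun k => isClosed_iInter fun _ => isClosed_le (by fun_prop) (by fun_prop))
  apply prod_stdGauss_le_two_mul hSc.measurableSet
  by_contra! hcon
  obtain ⟨E, F, G, hG, hGS, hE, hF, hEdet, hFdet⟩ := exists_tensor_family (Nat.div_le_self n 2)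
    (Real.exp_pos (-4)) (fun j hj => pow_le_pow_right_of_le_one' (by simp) (by omega)) hcon
  have hn1 : (1 : ℝ) ≤ n := by exact_mod_cast hn0
  have hsingle : ∀ i k : Fin n, |(Pi.single i 1 : Fin n → ℝ) k| ≤ n := by
    intro i k
    rw [Pi.single_apply]
    split_ifs
    · simpa using hn1
    · simp
  have hEb : ∀ i k, |E i k| ≤ n := by
    intro i k
    rcases hE i with ⟨y, hy⟩ | h
    · exact (hy.1 k).1
    · rw [h]; exact hsingle i k
  have hFb : ∀ i j k, |F i j k| ≤ n := by
    intro i j k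
    rcases hF i j with ⟨x, hx⟩ | h
    · exact (hx.1 k).2
    · rw [h]; exact hsingle j k
  set M : Matrix (Fin n × Fin n) (Fin n × Fin n) ℝ :=
    Matrix.of fun p q => E p.1 q.1 * F p.1 p.2 q.2 with hM
  have hent : ∀ g p, (M * Q.transpose) g p = ∑ r, Q p r * (E g.1 r.1 * F g.1 g.2 r.2) := by
    intro g p
    rw [Matrix.mul_apply]
    exact Finset.sum_congr rfl fun r _ => by simp [hM, mul_comm]
  -- K = n⁴: each entry is a sum of n² terms of size at most 1 · n · n, by truncation to the box.
  have hbound := Matrix.abs_det_mul_pow_le (M * Q.transpose) G s (tensorScale_pos hn0)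
    (tensorScale_le_one hn0) (K := (n : ℝ) ^ 4) (one_le_pow₀ hn1) (by
      intro g p
      rw [hent]
      refine (Finset.abs_sum_le_sum_abs _ _).trans ?_
      refine (Finset.sum_le_card_nsmul _ _ ((n : ℝ) ^ 2) fun r _ => ?_).trans_eq ?_
      · rw [abs_mul, abs_mul]
        calc |Q p r| * (|E g.1 r.1| * |F g.1 g.2 r.2|) ≤ 1 * (n * n) := by
              gcongr
              exacts [hQ _ _, hEb _ _, hFb _ _ _]
          _ = (n : ℝ) ^ 2 := by ring
      · simp [Finset.card_univ]; ring) (by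
      intro g hg p hp
      rw [hent]
      exact (hGS g hg).2 p hp)
  have hexp1 : Real.exp (-4) ≤ 1 := Real.exp_le_one_iff.2 (by norm_num)
  have hFd : ∀ i, Real.exp (-4) ^ (n / 2) ≤ |(F i).det| := by
    intro i
    rcases hFdet i with h | h
    · exact h
    · rw [h, Matrix.det_one, abs_one]
      exact pow_le_one₀ (Real.exp_pos _).le hexp1
  have hMdet : Real.exp (-4) ^ (2 * (n / 2) * n) ≤ |(M * Q.transpose).det| := by
    rw [Matrix.det_mul, Matrix.det_transpose, abs_mul, hdet, mul_one, hM, Matrix.det_row_tensor,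
      abs_mul, Finset.abs_prod, abs_pow]
    calc Real.exp (-4) ^ (2 * (n / 2) * n)
        = (∏ _i : Fin n, Real.exp (-4) ^ (n / 2)) * (Real.exp (-4) ^ (n / 2)) ^ n := by
          rw [Finset.prod_const, Finset.card_univ, Fintype.card_fin, ← pow_mul, ← pow_add]
          congr 1; ring
      _ ≤ _ := by
          rw [Fintype.card_fin]
          gcongr with i
          exact hFd i
  have hcontra := tensorScale_pow_contradiction (h := n / 2) hn0 (by omega) (by omega) hs
  have hτ := tensorScale_pos hn0
  rw [hG, Fintype.card_prod, Fintype.card_fin] at hbound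
  refine absurd (hcontra.trans_le ?_) (lt_irrefl _)
  exact (mul_le_mul_of_nonneg_right hMdet (by positivity)).trans hbound

/-- A Gaussian rank one tensor is far from a fixed subspace of small dimension. -/
theorem measure_tensor_le {n : ℕ} (hn : 4 ≤ n)
    (Q : Matrix (Fin n × Fin n) (Fin n × Fin n) ℝ) (hQ : ∀ p r, |Q p r| ≤ 1) (hdet : |Q.det| = 1)
    (s : Finset (Fin n × Fin n)) (hs : 18 * s.card ≤ n ^ 2) :
    ((stdGauss (Fin n)).prod (stdGauss (Fin n))) {z |
      ∀ k ∉ s, |∑ p, Q k p * (z.1 p.1 * z.2 p.2)| ≤ tensorScale n} ≤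
      ENNReal.ofReal (6 * n * Real.exp (-2 * n)) := by
  have hn' : (4 : ℝ) ≤ n := by exact_mod_cast hn
  set ν := (stdGauss (Fin n)).prod (stdGauss (Fin n)) with hν
  set T := {x : Fin n → ℝ | ∃ i, (n : ℝ) < |x i|} with hT
  set S := {z : (Fin n → ℝ) × (Fin n → ℝ) | (∀ i, |z.1 i| ≤ n ∧ |z.2 i| ≤ n) ∧
      ∀ k ∉ s, |∑ p, Q k p * (z.1 p.1 * z.2 p.2)| ≤ tensorScale n} with hS
  have hsub : {z : (Fin n → ℝ) × (Fin n → ℝ) |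
      ∀ k ∉ s, |∑ p, Q k p * (z.1 p.1 * z.2 p.2)| ≤ tensorScale n} ⊆
      S ∪ (T ×ˢ Set.univ ∪ Set.univ ×ˢ T) := by
    intro z hz
    by_cases h1 : z.1 ∈ T
    · exact Or.inr (Or.inl ⟨h1, trivial⟩)
    by_cases h2 : z.2 ∈ T
    · exact Or.inr (Or.inr ⟨trivial, h2⟩)
    · simp only [hT, Set.mem_ofPred_eq, not_exists, not_lt] at h1 h2
      exact Or.inl ⟨fun i => ⟨h1 i, h2 i⟩, hz⟩
  have hTle : stdGauss (Fin n) T ≤ ENNReal.ofReal (2 * n * Real.exp (-2 * n)) := by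
    refine (stdGauss_exists_abs_gt_le n n).trans ?_
    rw [← ENNReal.ofReal_natCast n, ← ENNReal.ofReal_mul (by positivity)]
    apply ENNReal.ofReal_le_ofReal
    have : Real.exp (8 - 4 * n) ≤ Real.exp (-2 * n) := Real.exp_le_exp.2 (by linarith)
    nlinarith
  have hSle : ν S ≤ ENNReal.ofReal (2 * Real.exp (-2 * n)) := by
    refine (measure_bounded_tensor_le (by omega) Q hQ hdet s hs).trans ?_
    rw [← ENNReal.ofReal_pow (Real.exp_pos _).le, ← Real.exp_nat_mul,
      ENNReal.ofReal_mul (by norm_num : (0 : ℝ) ≤ 2)]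
    have h1 : (n : ℝ) ≤ 2 * ((n - n / 2 : ℕ) : ℝ) := by exact_mod_cast (by omega)
    rw [ENNReal.ofReal_ofNat]
    exact mul_le_mul' le_rfl (ENNReal.ofReal_le_ofReal (Real.exp_le_exp.2 (by linarith)))
  calc ν _ ≤ ν S + (ν (T ×ˢ Set.univ) + ν (Set.univ ×ˢ T)) :=
        (measure_mono hsub).trans ((measure_union_le _ _).trans (by gcongr; exact measure_union_le _ _))
    _ ≤ ENNReal.ofReal (2 * Real.exp (-2 * n)) + (ENNReal.ofReal (2 * n * Real.exp (-2 * n)) +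
          ENNReal.ofReal (2 * n * Real.exp (-2 * n))) := by
        rw [hν, Measure.prod_prod, Measure.prod_prod, measure_univ, mul_one, one_mul]
        gcongr
    _ ≤ _ := by
        have he := Real.exp_pos (-2 * n)
        rw [← ENNReal.ofReal_add (by positivity) (by positivity),
          ← ENNReal.ofReal_add (by positivity) (by positivity)]
        apply ENNReal.ofReal_le_ofReal
        nlinarith

/-! ### Singular values and the reduction to a fixed subspace. -/

theorem Matrix.le_sigmaMin {ι : Type*} [Fintype ι] {m : ℕ} (hm : 0 < m) (A : Matrix ι (Fin m) ℝ)
    {ε : ℝ} (h : ∀ x, ε * ‖x‖ ≤ ‖Matrix.toEuclideanLin A x‖) : ε ≤ A.sigmaMin := by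
  set T := Matrix.toEuclideanLin A with hT
  have hlt : m - 1 < Module.finrank ℝ (EuclideanSpace ℝ (Fin m)) := by
    rw [finrank_euclideanSpace, Fintype.card_fin]; omega
  obtain ⟨v, hv⟩ := (T.hasEigenvalue_adjoint_comp_self_sq_singularValues hlt).exists_hasEigenvector
  have h1 : ‖T v‖ ^ 2 = T.singularValues (m - 1) ^ 2 * ‖v‖ ^ 2 := by
    rw [← real_inner_self_eq_norm_sq, ← LinearMap.adjoint_inner_left, ← LinearMap.comp_apply,
      hv.apply_eq_smul, real_inner_smul_left, real_inner_self_eq_norm_sq]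
    rfl
  have hv0 : 0 < ‖v‖ := norm_pos_iff.2 hv.2
  have h2 : ‖T v‖ = T.singularValues (m - 1) * ‖v‖ := by
    rw [← mul_pow] at h1
    exact (pow_left_inj₀ (norm_nonneg _) (mul_nonneg (T.singularValues_nonneg _) hv0.le)
      two_ne_zero).1 h1
  have h3 := h v
  rw [h2] at h3
  exact le_of_mul_le_mul_right h3 hv0

/-- An orthonormal basis all but `finrank W` of whose vectors are orthogonal to `W`. -/
theorem Submodule.exists_orthonormalBasis_inner_eq_zero {ι : Type*} [Fintype ι] [DecidableEq ι]
    (W : Submodule ℝ (EuclideanSpace ℝ ι)) :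
    ∃ (b : OrthonormalBasis ι ℝ (EuclideanSpace ℝ ι)) (s : Finset ι),
      s.card = Module.finrank ℝ W ∧ ∀ k ∉ s, ∀ w ∈ W, inner ℝ (b k) w = 0 := by
  have hle : Module.finrank ℝ W ≤ (Finset.univ : Finset ι).card := by
    have := W.finrank_le
    rwa [finrank_euclideanSpace] at this
  obtain ⟨s, -, hs⟩ := Finset.exists_subset_card_eq hle
  let c := stdOrthonormalBasis ℝ W
  let e : s ≃ Fin (Module.finrank ℝ W) := Fintype.equivOfCardEq (by simp [hs])
  let v : ι → EuclideanSpace ℝ ι := fun i => if h : i ∈ s then c (e ⟨i, h⟩) else 0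
  have hv : Orthonormal ℝ ((s : Set ι).domRestrict v) := by
    have h1 : Orthonormal ℝ fun i : s => ((c (e i) : W) : EuclideanSpace ℝ ι) :=
      (c.orthonormal.comp_linearIsometry W.subtypeₗᵢ).comp e e.injective
    have h2 : (s : Set ι).domRestrict v = fun i : s => ((c (e i) : W) : EuclideanSpace ℝ ι) := by
      funext i
      exact dif_pos i.2
    rw [h2]
    exact h1
  obtain ⟨b, hb⟩ := hv.exists_orthonormalBasis_extension_of_card_eq
    (by rw [finrank_euclideanSpace])
  refine ⟨b, s, hs, fun k hk w hw => ?_⟩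
  have hw' : w = ∑ i, c.repr ⟨w, hw⟩ i • (c i : EuclideanSpace ℝ ι) := by
    have := congrArg (Submodule.subtype W) (c.sum_repr ⟨w, hw⟩)
    simpa using this.symm
  rw [hw', inner_sum]
  refine Finset.sum_eq_zero fun i _ => ?_
  have hbi : b (e.symm i : ι) = c i := by
    rw [hb _ (e.symm i).2]
    simp [v]
  have hne : k ≠ e.symm i := fun h => hk (by rw [h]; exact (e.symm i).2)
  rw [inner_smul_right, ← hbi, b.inner_eq_zero hne, mul_zero]

theorem OrthonormalBasis.abs_det_of_coord {ι : Type*} [Fintype ι] [DecidableEq ι]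
    (b : OrthonormalBasis ι ℝ (EuclideanSpace ℝ ι)) :
    |(Matrix.of fun k p => b k p : Matrix ι ι ℝ).det| = 1 := by
  set Q : Matrix ι ι ℝ := Matrix.of fun k p => b k p
  have h : Q * Q.transpose = 1 := by
    ext i j
    have := orthonormal_iff_ite.1 b.orthonormal i j
    rw [Matrix.mul_apply, Matrix.one_apply, ← this, PiLp.inner_apply]
    exact Finset.sum_congr rfl fun r _ => by simp [Q, mul_comm]
  have h2 := congrArg Matrix.det h
  rw [Matrix.det_mul, Matrix.det_transpose, Matrix.det_one] at h2
  rw [← pow_left_inj₀ (abs_nonneg _) zero_le_one two_ne_zero, sq_abs, one_pow, sq, h2]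

theorem OrthonormalBasis.abs_coord_le_one {ι : Type*} [Fintype ι]
    (b : OrthonormalBasis ι ℝ (EuclideanSpace ℝ ι)) (k p : ι) : |b k p| ≤ 1 := by
  have := PiLp.norm_apply_le (b k) p
  rwa [b.orthonormal.1 k, Real.norm_eq_abs] at this

/-- If the perturbed column `j` is nearly dependent on the other columns of the Khatri–Rao product,
then the rank one tensor of the perturbations is nearly contained in a small subspace. -/
theorem exists_orthogonal_forms {n m : ℕ} (A B : Matrix (Fin n) (Fin m) ℝ) (j : Fin m)
    (u v : Fin n → ℝ) :
    ∃ (Q : Matrix (Fin n × Fin n) (Fin n × Fin n) ℝ) (s : Finset (Fin n × Fin n)),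
      (∀ p r, |Q p r| ≤ 1) ∧ |Q.det| = 1 ∧ s.card ≤ m + (n + n) ∧
      ∀ (e f : Fin n → ℝ) (A' B' : Matrix (Fin n) (Fin m) ℝ),
        (∀ i l, l ≠ j → A' i l = A i l ∧ B' i l = B i l) →
        (∀ i, A' i j = u i + e i ∧ B' i j = v i + f i) →
        ∀ y : EuclideanSpace ℝ (Fin m), y j = 1 → ∀ k ∉ s,
          |∑ p, Q k p * (e p.1 * f p.2)| ≤ ‖Matrix.toEuclideanLin (Matrix.khatriRao A' B') y‖ := by
  -- Generators of W: the other columns (with 0 in slot j), u⊗ℝⁿ and ℝⁿ⊗v. None involves e or f.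
  let w : Fin m ⊕ (Fin n ⊕ Fin n) → EuclideanSpace ℝ (Fin n × Fin n) :=
    Sum.elim (fun l => WithLp.toLp 2 fun p => if l = j then 0 else A p.1 l * B p.2 l)
      (Sum.elim (fun l => WithLp.toLp 2 fun p => u p.1 * (Pi.single l 1 : Fin n → ℝ) p.2)
        (fun l => WithLp.toLp 2 fun p => (Pi.single l 1 : Fin n → ℝ) p.1 * v p.2))
  obtain ⟨b, s, hs, hb⟩ :=
    (Submodule.span ℝ (Set.range w)).exists_orthonormalBasis_inner_eq_zero
  have hbw : ∀ k ∉ s, ∀ t, inner ℝ (b k) (w t) = 0 := fun k hk t =>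
    hb k hk _ (Submodule.subset_span ⟨t, rfl⟩)
  refine ⟨Matrix.of fun k p => b k p, s, b.abs_coord_le_one, b.abs_det_of_coord, ?_, ?_⟩
  · have := finrank_range_le_card (R := ℝ) w
    rw [hs]
    simpa [Set.finrank] using this
  intro e f A' B' hne hj y hy k hk
  have hdecomp : Matrix.toEuclideanLin (Matrix.khatriRao A' B') y =
      (WithLp.toLp 2 fun p : Fin n × Fin n => e p.1 * f p.2) + ∑ l, y l • w (Sum.inl l) +
        ∑ l, (v l + f l) • w (Sum.inr (Sum.inl l)) + ∑ l, e l • w (Sum.inr (Sum.inr l)) := by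
    ext p
    simp only [Matrix.toEuclideanLin, Matrix.toLpLin_apply, Matrix.mulVec, dotProduct, Matrix.khatriRao,
      Matrix.of_apply, PiLp.add_apply, WithLp.ofLp_sum, Finset.sum_apply, smul_eq_mul, w,
      Sum.elim_inl, Sum.elim_inr, Pi.single_apply, WithLp.ofLp_smul, Pi.smul_apply]
    have h1 : ∑ l, A' p.1 l * B' p.2 l * y l = A' p.1 j * B' p.2 j +
        ∑ l, y l * (if l = j then 0 else A p.1 l * B p.2 l) := by
      rw [← Finset.add_sum_erase _ _ (Finset.mem_univ j), ← Finset.add_sum_erase Finset.univ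
        (fun l => y l * (if l = j then 0 else A p.1 l * B p.2 l)) (Finset.mem_univ j), hy]
      simp only [mul_one, if_true, mul_zero, zero_add]
      congr 1
      refine Finset.sum_congr rfl fun l hl => ?_
      have hl' := Finset.ne_of_mem_erase hl
      rw [if_neg hl', (hne _ l hl').1, (hne _ l hl').2]
      ring
    rw [h1, (hj _).1, (hj _).2]
    simp
    ring
  have hinner : inner ℝ (b k) (Matrix.toEuclideanLin (Matrix.khatriRao A' B') y) =
      ∑ p, (Matrix.of fun k p => b k p : Matrix _ _ ℝ) k p * (e p.1 * f p.2) := by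
    rw [hdecomp, inner_add_right, inner_add_right, inner_add_right, inner_sum, inner_sum, inner_sum]
    simp only [inner_smul_right, hbw k hk, mul_zero, Finset.sum_const_zero, add_zero]
    rw [PiLp.inner_apply]
    exact Finset.sum_congr rfl fun p _ => by simp [mul_comm]
  rw [← hinner]
  refine (abs_real_inner_le_norm _ _).trans ?_
  rw [b.orthonormal.1 k, one_mul]

/-! ### Conditioning on the other columns. -/

section Independence

variable {Ω S : Type*} [MeasurableSpace Ω] {μ : Measure Ω} {G : S → Ω → ℝ}

theorem ProbabilityTheory.iIndepFun.indepFun_of_disjoint_range {α β : Type*} [Fintype α] [Fintype β]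
    (hG : iIndepFun G μ) (hm : ∀ s, AEMeasurable (G s) μ) (g : α → S) (h : β → S)
    (hgh : ∀ a b, g a ≠ h b) :
    IndepFun (fun ω a => G (g a) ω) (fun ω b => G (h b) ω) μ := by
  classical
  have hd : Disjoint (Finset.univ.image g) (Finset.univ.image h) := by
    rw [Finset.disjoint_left]
    intro s hs ht
    simp only [Finset.mem_image, Finset.mem_univ, true_and] at hs ht
    obtain ⟨a, rfl⟩ := hs
    obtain ⟨b, hb⟩ := ht
    exact hgh a b hb.symm
  exact (hG.indepFun_finset₀ _ _ hd hm).comp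
    (φ := fun (z : Finset.univ.image g → ℝ) a => z ⟨g a, by simp⟩)
    (ψ := fun (z : Finset.univ.image h → ℝ) b => z ⟨h b, by simp⟩)
    (measurable_pi_lambda _ fun a => measurable_pi_apply _)
    (measurable_pi_lambda _ fun a => measurable_pi_apply _)

variable [IsProbabilityMeasure μ]

theorem map_eq_stdGauss {α : Type*} [Fintype α] (hG : iIndepFun G μ)
    (hl : ∀ s, HasLaw (G s) (gaussianReal 0 1) μ) {g : α → S} (hg : g.Injective) :
    μ.map (fun ω a => G (g a) ω) = stdGauss α := by
  rw [(iIndepFun_iff_map_fun_eq_pi_map (fun a => (hl (g a)).aemeasurable)).1 (hG.precomp hg)]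
  simp only [(hl _).map_eq]

end Independence

/-- The index of an entry of the pair of perturbations. -/
abbrev PairIndex (n m : ℕ) : Type := (Fin n × Fin m) ⊕ (Fin n × Fin m)

section Column

variable {n m : ℕ} (U V : Matrix (Fin n) (Fin m) ℝ)

/-- The Khatri–Rao product of the matrices perturbed by `g`. -/
def perturbedProduct (g : PairIndex n m → ℝ) : Matrix (Fin n × Fin n) (Fin m) ℝ :=
  Matrix.khatriRao (Matrix.of fun i l => U i l + g (Sum.inl (i, l)))
    (Matrix.of fun i l => V i l + g (Sum.inr (i, l)))

/-- The perturbations for which column `j` is within `τ` of the span of the other columns. -/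
def nearDependent (j : Fin m) (τ : ℝ) : Set (PairIndex n m → ℝ) :=
  {g | ∃ y : EuclideanSpace ℝ (Fin m), y j = 1 ∧
    ‖Matrix.toEuclideanLin (perturbedProduct U V g) y‖ < τ}

/-- Supplies measurability: the union over y is uncountable, but each member is open in g. -/
theorem isOpen_nearDependent (j : Fin m) (τ : ℝ) : IsOpen (nearDependent U V j τ) := by
  have : nearDependent U V j τ = ⋃ y ∈ {y : EuclideanSpace ℝ (Fin m) | y j = 1},
      {g | ‖Matrix.toEuclideanLin (perturbedProduct U V g) y‖ < τ} := by
    ext g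
    simp [nearDependent]
  rw [this]
  refine isOpen_biUnion fun y _ => isOpen_lt (Continuous.norm ?_) continuous_const
  simp only [Matrix.toEuclideanLin, Matrix.toLpLin_apply]
  refine (PiLp.continuous_toLp 2 _).comp (Continuous.matrix_mulVec ?_ continuous_const)
  refine continuous_matrix fun p l => ?_
  simp only [perturbedProduct, Matrix.khatriRao, Matrix.of_apply]
  fun_prop

/-- Glue the entries in column `j` to the other entries. -/
def gluePair (j : Fin m) (z : ((Fin n → ℝ) × (Fin n → ℝ)) ×
    ({t : PairIndex n m // Sum.elim Prod.snd Prod.snd t ≠ j} → ℝ)) : PairIndex n m → ℝ := fun t =>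
  if h : Sum.elim Prod.snd Prod.snd t ≠ j then z.2 ⟨t, h⟩
  else Sum.elim (fun p => z.1.1 p.1) (fun p => z.1.2 p.1) t

theorem continuous_gluePair (j : Fin m) : Continuous (gluePair (n := n) j) := by
  refine continuous_pi fun t => ?_
  unfold gluePair
  split_ifs with h
  · fun_prop
  · rcases t with t | t
    · simp only [Sum.elim_inl]; fun_prop
    · simp only [Sum.elim_inr]; fun_prop

theorem measure_slice_nearDependent_le (hn : 4 ≤ n) (hnm : 18 * (m + (n + n)) ≤ n ^ 2) (j : Fin m)
    (y : {t : PairIndex n m // Sum.elim Prod.snd Prod.snd t ≠ j} → ℝ) :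
    ((stdGauss (Fin n)).prod (stdGauss (Fin n)))
      {x | gluePair j (x, y) ∈ nearDependent U V j (tensorScale n)} ≤
      ENNReal.ofReal (6 * n * Real.exp (-2 * n)) := by
  let A : ((Fin n → ℝ) × (Fin n → ℝ)) → Matrix (Fin n) (Fin m) ℝ := fun x =>
    Matrix.of fun i l => U i l + gluePair j (x, y) (Sum.inl (i, l))
  let B : ((Fin n → ℝ) × (Fin n → ℝ)) → Matrix (Fin n) (Fin m) ℝ := fun x =>
    Matrix.of fun i l => V i l + gluePair j (x, y) (Sum.inr (i, l))
  -- The choice of 0 is immaterial: only columns other than j are used, and `y` determines them.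
  obtain ⟨Q, s, hQ, hdet, hs, hform⟩ := exists_orthogonal_forms (A 0) (B 0) j (fun i => U i j)
    (fun i => V i j)
  refine (measure_mono ?_).trans (measure_tensor_le hn Q hQ hdet s (by omega))
  rintro x ⟨v, hv, hlt⟩ k hk
  refine (hform x.1 x.2 (A x) (B x) ?_ ?_ v hv k hk).trans hlt.le
  · intro i l hl
    simp [A, B, gluePair, hl]
  · intro i
    simp [A, B, gluePair]

variable {Ω : Type*} [MeasurableSpace Ω] {μ : Measure Ω} [IsProbabilityMeasure μ]
  {G : PairIndex n m → Ω → ℝ}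

theorem measure_nearDependent_le (hn : 4 ≤ n) (hnm : 18 * (m + (n + n)) ≤ n ^ 2)
    (hG : iIndepFun G μ) (hl : ∀ t, HasLaw (G t) (gaussianReal 0 1) μ) (j : Fin m) :
    μ {ω | (fun t => G t ω) ∈ nearDependent U V j (tensorScale n)} ≤
      ENNReal.ofReal (6 * n * Real.exp (-2 * n)) := by
  have hm : ∀ t, AEMeasurable (G t) μ := fun t => (hl t).aemeasurable
  let e : Ω → Fin n → ℝ := fun ω i => G (Sum.inl (i, j)) ω
  let f : Ω → Fin n → ℝ := fun ω i => G (Sum.inr (i, j)) ω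
  let Y : Ω → {t : PairIndex n m // Sum.elim Prod.snd Prod.snd t ≠ j} → ℝ := fun ω t => G t ω
  have he : AEMeasurable e μ := aemeasurable_pi_lambda _ fun i => hm _
  have hf : AEMeasurable f μ := aemeasurable_pi_lambda _ fun i => hm _
  have hY : AEMeasurable Y μ := aemeasurable_pi_lambda _ fun i => hm _
  have hef : μ.map (fun ω => (e ω, f ω)) = (stdGauss (Fin n)).prod (stdGauss (Fin n)) := by
    have hind : IndepFun e f μ := hG.indepFun_of_disjoint_range hm
      (fun i => Sum.inl (i, j)) (fun i => Sum.inr (i, j)) (by simp)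
    rw [(indepFun_iff_map_prod_eq_prod_map_map he hf).1 hind]
    congr 1
    · exact map_eq_stdGauss hG hl (g := fun i => Sum.inl (i, j)) fun a b hab => by simpa using hab
    · exact map_eq_stdGauss hG hl (g := fun i => Sum.inr (i, j)) fun a b hab => by simpa using hab
  have hXY : IndepFun (fun ω => (e ω, f ω)) Y μ := by
    have h1 := hG.indepFun_of_disjoint_range hm
      (Sum.elim (fun i : Fin n => Sum.inl (i, j)) (fun i : Fin n => Sum.inr (i, j)))
      (fun t : {t : PairIndex n m // Sum.elim Prod.snd Prod.snd t ≠ j} => (t : PairIndex n m))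
      (by
        rintro (a | a) ⟨t, ht⟩ rfl <;> simp at ht)
    exact h1.comp (φ := fun z : Fin n ⊕ Fin n → ℝ =>
      ((fun i => z (Sum.inl i), fun i => z (Sum.inr i)) : (Fin n → ℝ) × (Fin n → ℝ)))
      (by fun_prop) measurable_id
  have hlaw : μ.map (fun ω => ((e ω, f ω), Y ω)) =
      ((stdGauss (Fin n)).prod (stdGauss (Fin n))).prod (μ.map Y) := by
    rw [(indepFun_iff_map_prod_eq_prod_map_map (he.prodMk hf) hY).1 hXY, hef]
  have hB : MeasurableSet (gluePair (n := n) j ⁻¹' nearDependent U V j (tensorScale n)) :=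
    ((isOpen_nearDependent U V j _).preimage (continuous_gluePair j)).measurableSet
  have hglue : ∀ ω, gluePair j ((e ω, f ω), Y ω) = fun t => G t ω := by
    intro ω
    funext t
    unfold gluePair
    split_ifs with h
    · rfl
    · rcases t with ⟨i, l⟩ | ⟨i, l⟩ <;> (have hlj : l = j := by simpa using h) <;> subst hlj <;> rfl
  have hset : {ω | (fun t => G t ω) ∈ nearDependent U V j (tensorScale n)} =
      (fun ω => ((e ω, f ω), Y ω)) ⁻¹' (gluePair j ⁻¹' nearDependent U V j (tensorScale n)) := by
    ext ω
    simp only [Set.mem_preimage, hglue]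
    rfl
  have : IsProbabilityMeasure (μ.map Y) := Measure.isProbabilityMeasure_map hY
  rw [hset, ← Measure.map_apply_of_aemeasurable ((he.prodMk hf).prodMk hY) hB, hlaw,
    Measure.prod_apply_symm hB]
  refine (lintegral_mono fun y => measure_slice_nearDependent_le U V hn hnm j y).trans ?_
  simp

/-- Dividing `x` by its largest coordinate makes that coordinate 1 and leaves norm at most √m ≤ n,
hence the loss of a factor n. -/
theorem mem_nearDependent_of_norm_lt (hmn : m ≤ n ^ 2) {τ : ℝ} {g : PairIndex n m → ℝ}
    (hn : 0 < n) (hτ : 0 < τ) {x : EuclideanSpace ℝ (Fin m)}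
    (hx : ‖Matrix.toEuclideanLin (perturbedProduct U V g) x‖ < τ / n * ‖x‖) :
    ∃ j, g ∈ nearDependent U V j τ := by
  have hn' : (0 : ℝ) < n := by exact_mod_cast hn
  have hx0 : x ≠ 0 := by
    rintro rfl
    simp at hx
  have hne : (Finset.univ : Finset (Fin m)).Nonempty := by
    by_contra h
    apply hx0
    ext i
    exact absurd ⟨i, Finset.mem_univ i⟩ h
  obtain ⟨j, -, hj⟩ := Finset.exists_max_image Finset.univ (fun i => |x i|) hne
  have hnorm : ‖x‖ ≤ n * |x j| := by
    refine le_of_sq_le_sq ?_ (by positivity)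
    rw [EuclideanSpace.norm_sq_eq]
    calc ∑ i, ‖x i‖ ^ 2 ≤ ∑ _i : Fin m, |x j| ^ 2 := by
          refine Finset.sum_le_sum fun i hi => ?_
          rw [Real.norm_eq_abs]
          exact pow_le_pow_left₀ (abs_nonneg _) (hj i hi) 2
      _ = m * |x j| ^ 2 := by simp
      _ ≤ (n : ℝ) ^ 2 * |x j| ^ 2 := by
          have : (m : ℝ) ≤ (n : ℝ) ^ 2 := by exact_mod_cast hmn
          gcongr
      _ = _ := by ring
  have hxj : 0 < |x j| := by
    have := norm_pos_iff.2 hx0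
    by_contra h
    nlinarith
  refine ⟨j, (x j)⁻¹ • x, by simpa using inv_mul_cancel₀ (abs_pos.1 hxj), ?_⟩
  rw [map_smul, norm_smul, norm_inv, Real.norm_eq_abs, inv_mul_lt_iff₀ hxj]
  calc _ < τ / n * ‖x‖ := hx
    _ ≤ τ / n * (n * |x j|) := by gcongr
    _ = |x j| * τ := by field_simp

theorem measure_exists_norm_lt_le (hn : 4 ≤ n) (hnm : 18 * (m + (n + n)) ≤ n ^ 2)
    (hG : iIndepFun G μ) (hl : ∀ t, HasLaw (G t) (gaussianReal 0 1) μ) :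
    μ {ω | ∃ x, ‖Matrix.toEuclideanLin (perturbedProduct U V fun t => G t ω) x‖ <
      tensorScale n / n * ‖x‖} ≤ m * ENNReal.ofReal (6 * n * Real.exp (-2 * n)) := by
  have hsub : {ω | ∃ x, ‖Matrix.toEuclideanLin (perturbedProduct U V fun t => G t ω) x‖ <
      tensorScale n / n * ‖x‖} ⊆
      ⋃ j, {ω | (fun t => G t ω) ∈ nearDependent U V j (tensorScale n)} := by
    rintro ω ⟨x, hx⟩
    obtain ⟨j, hj⟩ := mem_nearDependent_of_norm_lt U V (by omega) (by omega)
      (tensorScale_pos (by omega)) hx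
    exact Set.mem_iUnion.2 ⟨j, hj⟩
  refine (measure_mono hsub).trans ((measure_iUnion_le _).trans ?_)
  rw [tsum_fintype]
  refine (Finset.sum_le_card_nsmul _ _ _ fun j _ =>
    measure_nearDependent_le U V hn hnm hG hl j).trans_eq ?_
  rw [Finset.card_univ, Fintype.card_fin, nsmul_eq_mul]

end Column

/-! ### Rescaling to unit variance and conclusion. -/

theorem khatriRao_eq_smul_perturbedProduct {n m : ℕ} (U V E F : Matrix (Fin n) (Fin m) ℝ) {ρ : ℝ}
    (hρ : ρ ≠ 0) :
    Matrix.khatriRao (U + E) (V + F) = ρ ^ 2 • perturbedProduct (ρ⁻¹ • U) (ρ⁻¹ • V)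
      (fun t => ρ⁻¹ * Sum.elim (fun p => E p.1 p.2) (fun p => F p.1 p.2) t) := by
  ext p l
  simp only [Matrix.khatriRao, perturbedProduct, Matrix.of_apply, Matrix.add_apply,
    Matrix.smul_apply, smul_eq_mul, Sum.elim_inl, Sum.elim_inr]
  field_simp

theorem ProbabilityTheory.HasLaw.inv_mul_gaussianReal {Ω : Type*} [MeasurableSpace Ω]
    {μ : Measure Ω} {X : Ω → ℝ} {ρ : ℝ} (hX : HasLaw X (gaussianReal 0 ⟨ρ ^ 2, sq_nonneg ρ⟩) μ)
    (hρ : ρ ≠ 0) : HasLaw (fun ω => ρ⁻¹ * X ω) (gaussianReal 0 1) μ := by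
  convert! gaussianReal_const_mul hX ρ⁻¹ using 2
  · simp
  · apply NNReal.eq
    change (1 : ℝ) = ρ⁻¹ ^ 2 * ρ ^ 2
    field_simp

theorem six_mul_pow_three_mul_exp_le {n : ℕ} (hn : 100 ≤ n) :
    (n : ℝ) ^ 2 * (6 * n * Real.exp (-2 * n)) ≤ Real.exp (-n) := by
  have hn' : (100 : ℝ) ≤ n := by exact_mod_cast hn
  have h1 : (n : ℝ) ^ 5 / 120 ≤ Real.exp n := by
    have := Real.pow_div_factorial_le_exp (n : ℝ) (by positivity) 5
    simpa [Nat.factorial] using this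
  have h2 : 6 * (n : ℝ) ^ 3 ≤ Real.exp n := by
    refine le_trans ?_ h1
    have : (n : ℝ) ^ 3 * 720 ≤ (n : ℝ) ^ 3 * n ^ 2 := by
      gcongr
      nlinarith
    linarith
  have h3 : Real.exp (-2 * n) * Real.exp n = Real.exp (-n) := by
    rw [← Real.exp_add]; congr 1; ring
  calc (n : ℝ) ^ 2 * (6 * n * Real.exp (-2 * n)) = Real.exp (-2 * n) * (6 * (n : ℝ) ^ 3) := by ring
    _ ≤ Real.exp (-2 * n) * Real.exp n := by gcongr
    _ = _ := h3

theorem theorem6p4 :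
    ∃ C c κ : ℝ, 0 < C ∧ 0 < c ∧ 0 < κ ∧ ∃ a b : ℕ,
      ∀ (n m : ℕ) (ρ : ℝ), 0 < m → (m : ℝ) ≤ (n : ℝ) ^ 2 / C → 0 < ρ →
      ∀ (U V : Matrix (Fin n) (Fin m) ℝ)
        (Ω : Type*) [MeasurableSpace Ω] (μ : Measure Ω) [IsProbabilityMeasure μ]
        (E F : Ω → Matrix (Fin n) (Fin m) ℝ),
        (∀ i j, HasLaw (fun ω => E ω i j) (gaussianReal 0 ⟨ρ ^ 2, sq_nonneg ρ⟩) μ) →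
        (∀ i j, HasLaw (fun ω => F ω i j) (gaussianReal 0 ⟨ρ ^ 2, sq_nonneg ρ⟩) μ) →
        iIndepFun (fun (s : (Fin n × Fin m) ⊕ (Fin n × Fin m)) (ω : Ω) =>
          Sum.elim (fun p => E ω p.1 p.2) (fun p => F ω p.1 p.2) s) μ →
        1 - Real.exp (-(c * n)) ≤
          μ.real {ω | κ * ρ ^ a * (1 / (n : ℝ)) ^ b ≤
            (Matrix.khatriRao (U + E ω) (V + F ω)).sigmaMin} := by
  -- C = 10000 and m ≥ 1 force n ≥ 100, so 18(m + 2n) ≤ n². The exponent 109 is 6 · 18 from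
  -- `tensorScale` plus 1 from the normalisation; a = 2 since the product is bilinear.
  refine ⟨10000, 1, 2⁻¹ * (Real.exp 4 ^ 18)⁻¹, by norm_num, one_pos, by positivity, 2, 109, ?_⟩
  intro n m ρ hm hmn hρ U V Ω _ μ _ E F hE hF hind
  have hmn' : 10000 * m ≤ n ^ 2 := by
    rw [le_div_iff₀ (by norm_num)] at hmn
    have : (m : ℝ) * 10000 ≤ (n : ℝ) ^ 2 := hmn
    have h2 : m * 10000 ≤ n ^ 2 := by exact_mod_cast this
    omega
  have hn : 100 ≤ n := by
    by_contra! h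
    nlinarith
  have hnm : 18 * (m + (n + n)) ≤ n ^ 2 := by nlinarith
  have hn0 : (n : ℝ) ≠ 0 := by positivity
  set G : PairIndex n m → Ω → ℝ := fun t ω =>
    ρ⁻¹ * Sum.elim (fun p => E ω p.1 p.2) (fun p => F ω p.1 p.2) t with hGdef
  have hG : iIndepFun G μ :=
    hind.comp (fun _ x => ρ⁻¹ * x) fun _ => measurable_const_mul _
  have hl : ∀ t, HasLaw (G t) (gaussianReal 0 1) μ := by
    rintro (p | p)
    · exact (hE p.1 p.2).inv_mul_gaussianReal hρ.ne'
    · exact (hF p.1 p.2).inv_mul_gaussianReal hρ.ne'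
  set good := {ω | 2⁻¹ * (Real.exp 4 ^ 18)⁻¹ * ρ ^ 2 * (1 / (n : ℝ)) ^ 109 ≤
    (Matrix.khatriRao (U + E ω) (V + F ω)).sigmaMin} with hgood
  set bad := {ω | ∃ x, ‖Matrix.toEuclideanLin
    (perturbedProduct (ρ⁻¹ • U) (ρ⁻¹ • V) fun t => G t ω) x‖ < tensorScale n / n * ‖x‖} with hbad
  have hscale : 2⁻¹ * (Real.exp 4 ^ 18)⁻¹ * ρ ^ 2 * (1 / (n : ℝ)) ^ 109 =
      ρ ^ 2 * (tensorScale n / n) := by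
    unfold tensorScale
    field_simp
  -- Covering and subadditivity avoid any need for `good` or `bad` to be measurable.
  have hcover : Set.univ ⊆ good ∪ bad := by
    intro ω _
    by_cases hω : ω ∈ bad
    · exact Or.inr hω
    · left
      rw [hgood, Set.mem_ofPred_eq, hscale]
      have hτ : 0 < tensorScale n := tensorScale_pos (by omega)
      refine Matrix.le_sigmaMin hm _ fun x => ?_
      have hx : tensorScale n / n * ‖x‖ ≤ ‖Matrix.toEuclideanLin
          (perturbedProduct (ρ⁻¹ • U) (ρ⁻¹ • V) fun t => G t ω) x‖ :=
        not_lt.1 fun h => hω ⟨x, h⟩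
      rw [khatriRao_eq_smul_perturbedProduct U V (E ω) (F ω) hρ.ne', map_smul,
        LinearMap.smul_apply, norm_smul, Real.norm_of_nonneg (sq_nonneg ρ), mul_assoc]
      gcongr
  have hbadle : μ.real bad ≤ Real.exp (-(1 * n)) := by
    refine ENNReal.toReal_le_of_le_ofReal (Real.exp_pos _).le ?_
    refine (measure_exists_norm_lt_le _ _ (by omega) hnm hG hl).trans ?_
    rw [← ENNReal.ofReal_natCast m, ← ENNReal.ofReal_mul (by positivity), one_mul]
    apply ENNReal.ofReal_le_ofReal
    refine le_trans ?_ (six_mul_pow_three_mul_exp_le hn)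
    gcongr
    exact_mod_cast (by omega : m ≤ n ^ 2)
  have h1 : 1 ≤ μ.real good + μ.real bad := by
    calc (1 : ℝ) = μ.real Set.univ := by simp
      _ ≤ μ.real (good ∪ bad) := measureReal_mono hcover
      _ ≤ _ := measureReal_union_le _ _
  linarith
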